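/- Let $T,L>0$, $\Omega=(0,L)$, $H=L^2(\Omega)$, $V=H^1(\Omega)$ with $\|\varphi\|_V^2=\|\varphi\|_H^2+\|\varphi'\|_H^2$, and $V_\circ=\{\varphi\in V:\varphi(0)=0\}$ with inner product $\langle\varphi,\phi\rangle_{V_\circ}=\int_\Omega\varphi'\phi'\,\mathrm dx$. Elements of $V$ are identified with their continuous representatives on $\overline\Omega=[0,L]$, and $\|\cdot\|_{C(\overline\Omega)}$ is the maximum norm. There are constants $c_{\mathsf e},c_{\mathsf P}>0$ such that $\|\varphi\|_{C(\overline\Omega)}\le c_{\mathsf e}\|\varphi\|_V$ for all $\varphi\in V$ and $\|\varphi\|_H\le c_{\mathsf P}\|\varphi\|_{V_\circ}$ for all $\varphi\in V_\circ$; fix any such constants and put $c_{\mathsf{eP}}=c_{\mathsf e}(c_{\mathsf P}^2+1)^{1/2}$. Let $\kappa_2\in C^{0,1}(\overline\Omega)$ with $\kappa_2\ge\kappa_{\mathsf a}$ on $\overline\Omega$ for a constant $\kappa_{\mathsf a}>0$, let $\mu_{\mathsf a},\mu_{\mathsf b}\in\mathbb R^4$ with $0<\mu_{\mathsf a}\le\mu_{\mathsf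 b}$ componentwise, and let $M>1$. Then there is a constant $c(M)>0$ such that the following holds for every parameter vector $\mu\in\mathbb R^4$ with $\mu_{\mathsf a}\le\mu\le\mu_{\mathsf b}$ componentwise, every $y\in C([0,T]\times[0,L])$ with $1/M\le y\le M$, all $u_{\mathsf a},u_{\mathsf b}\in L^\infty(0,T)$ with $u_{\mathsf a}\le u_{\mathsf b}$ a.e., and every $u\in L^2(0,T)$ with $u_{\mathsf a}\le u\le u_{\mathsf b}$ a.e. in $(0,T)$ (so $c(M)$ does not depend on $\mu,y,u_{\mathsf a},u_{\mathsf b},u$). There is exactly one $q\in L^\infty(0,T;V_\circ)$ that is a weak solution of $$-\mu_3(\kappa_2q_x)_x+\mu_4\sqrt y\,\sinh q=0\ \text{ in }\Omega,\qquad q(t,0)=0,\qquad \mu_3\kappa_2(L)q_x(t,L)=u(t),$$ that is, for almost every $t\in(0,T)$ and all $\varphi\in V_\circ$, $$\mu_3\int_\Omega\kappa_2(x)q_x(t,x)\varphi'(x)\,\mathrm dx+\mu_4\int_\Omega\sqrt{y(t,x)}\,\sinh(q(t,x))\,\varphi(x)\,\mathrm dx=u(t)\varphi(L),$$ and it satisfies,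 with $c_{\mathscr U}=\max\{\|u_{\mathsf a}\|_{L^\infty(0,T)},\|u_{\mathsf b}\|_{L^\infty(0,T)}\}$, $$\|q(t)\|_{C(\overline\Omega)}\le c_{\mathsf{eP}}\|q(t)\|_{V_\circ}\le c(M)|u(t)|\le c(M)\,c_{\mathscr U}\quad\text{for almost every }t\in(0,T).$$ -/

import Mathlib

open MeasureTheory Set Filter
open scoped ContDiff

noncomputable section

namespace Elliptic

/-- Lebesgue measure on the open interval `(0, a)`. -/
abbrev vol (a : ℝ) : Measure ℝ := volume.restrict (Ioo 0 a)

/-- The Hilbert space `H = L²(0, L)`. -/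
abbrev H (L : ℝ) : Type := Lp ℝ 2 (vol L)

/-- `w ∈ L²(0, L)` is the weak derivative of `φ ∈ L²(0, L)`: integration by parts holds against
every smooth function with compact support in `(0, L)`. -/
def IsWeakDeriv (L : ℝ) (φ w : H L) : Prop :=
  ∀ ψ : ℝ → ℝ, ContDiff ℝ ∞ ψ → HasCompactSupport ψ → tsupport ψ ⊆ Ioo 0 L →
    ∫ x in Ioo 0 L, φ x * deriv ψ x = - ∫ x in Ioo 0 L, w x * ψ x

theorem H.integrableOn {L : ℝ} (φ : H L) : IntegrableOn φ (Ioo 0 L) :=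
  (Lp.memLp φ).integrable (by norm_num)

theorem H.integrableOn_mul {L : ℝ} (φ : H L) {ψ : ℝ → ℝ} (hψ : Continuous ψ)
    (hc : HasCompactSupport ψ) : IntegrableOn (fun x => φ x * ψ x) (Ioo 0 L) := by
  obtain ⟨C, hC⟩ := hc.exists_bound_of_continuous hψ
  exact φ.integrableOn.mul_bdd (c := C) hψ.aestronglyMeasurable (ae_of_all _ hC)

/-- The Hilbert space `V = H¹(0, L)`, realised as the graph of the weak derivative: the pairs
`(φ, φ')` of elements of `L²(0, L)` in which the second is the weak derivative of the first.
The norm inherited from the `ℓ²`-product is `‖φ‖_V = (‖φ‖_H ^ 2 + ‖φ'‖_H ^ 2) ^ (1 / 2)`. -/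
def V (L : ℝ) : Submodule ℝ (WithLp 2 (H L × H L)) where
  carrier := {p | IsWeakDeriv L p.fst p.snd}
  zero_mem' := by
    intro ψ _ _ _
    have h := Lp.coeFn_zero ℝ 2 (vol L)
    have e1 : ∫ x in Ioo 0 L, (0 : H L) x * deriv ψ x = 0 := by
      rw [integral_congr_ae (g := fun _ => (0 : ℝ))]
      · simp
      · filter_upwards [h] with x hx
        rw [hx, Pi.zero_apply, zero_mul]
    have e2 : ∫ x in Ioo 0 L, (0 : H L) x * ψ x = 0 := by
      rw [integral_congr_ae (g := fun _ => (0 : ℝ))]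
      · simp
      · filter_upwards [h] with x hx
        rw [hx, Pi.zero_apply, zero_mul]
    simp only [WithLp.zero_fst, WithLp.zero_snd, e1, e2, neg_zero]
  add_mem' := by
    intro p q hp hq ψ h1 h2 h3
    have hd : Continuous (deriv ψ) := h1.continuous_deriv (by simp)
    have key (f g : H L) {η : ℝ → ℝ} (hη : Continuous η) (hηc : HasCompactSupport η) :
        ∫ x in Ioo 0 L, (f + g) x * η x
          = (∫ x in Ioo 0 L, f x * η x) + ∫ x in Ioo 0 L, g x * η x := by
      rw [← integral_add (f.integrableOn_mul hη hηc) (g.integrableOn_mul hη hηc)]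
      apply integral_congr_ae
      filter_upwards [Lp.coeFn_add f g] with x hx
      rw [hx, Pi.add_apply, add_mul]
    simp only [WithLp.add_fst, WithLp.add_snd]
    rw [key _ _ hd h2.deriv, key _ _ h1.continuous h2, hp ψ h1 h2 h3, hq ψ h1 h2 h3]
    ring
  smul_mem' := by
    intro c p hp ψ h1 h2 h3
    have key (f : H L) (η : ℝ → ℝ) :
        ∫ x in Ioo 0 L, (c • f) x * η x = c * ∫ x in Ioo 0 L, f x * η x := by
      rw [← integral_const_mul]
      apply integral_congr_ae
      filter_upwards [Lp.coeFn_smul c f] with x hx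
      simp [hx, mul_assoc]
    simp only [WithLp.smul_fst, WithLp.smul_snd]
    rw [key, key, hp ψ h1 h2 h3]
    ring

/-- An integrable function on `(0, L)` that is orthogonal to the derivatives of all test functions
is almost everywhere constant. -/
theorem ae_const_of_integral_mul_deriv {L : ℝ} (hL : 0 < L) {g : ℝ → ℝ}
    (hg : IntegrableOn g (Ioo 0 L))
    (h : ∀ ψ : ℝ → ℝ, ContDiff ℝ ∞ ψ → HasCompactSupport ψ → tsupport ψ ⊆ Ioo 0 L →
      ∫ x in Ioo 0 L, g x * deriv ψ x = 0) :
    ∃ c : ℝ, ∀ᵐ x ∂(vol L), g x = c := by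
  have int_mul (η : ℝ → ℝ) (h1 : Continuous η) (h2 : HasCompactSupport η) :
      IntegrableOn (fun x => g x * η x) (Ioo 0 L) := by
    obtain ⟨C, hC⟩ := h2.exists_bound_of_continuous h1
    exact hg.mul_bdd (c := C) h1.aestronglyMeasurable (ae_of_all _ hC)
  let B : ContDiffBump (L / 2) := ⟨L / 8, L / 4, by positivity, by linarith⟩
  let χ : ℝ → ℝ := B.normed volume
  have χ1 : ContDiff ℝ ∞ χ := B.contDiff_normed
  have χ2 : HasCompactSupport χ := B.hasCompactSupport_normed
  have χ3 : tsupport χ ⊆ Ioo 0 L := by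
    intro x hx
    have hx' := B.tsupport_normed_eq (μ := volume) ▸ hx
    have : x ∈ Metric.closedBall (L / 2) (L / 4) := hx'
    rw [Real.closedBall_eq_Icc] at this
    constructor <;> linarith [this.1, this.2]
  have χ4 : ∫ x, χ x = 1 := B.integral_normed
  refine ⟨∫ x in Ioo 0 L, g x * χ x, ?_⟩
  set c := ∫ x in Ioo 0 L, g x * χ x with hc
  have main := isOpen_Ioo.ae_eq_zero_of_integral_contDiff_smul_eq_zero (U := Ioo 0 L) (μ := volume)
    (f := fun x => g x - c)
    ((hg.sub (integrableOn_const (by simp))).locallyIntegrableOn) ?_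
  · rw [ae_restrict_iff' measurableSet_Ioo]
    filter_upwards [main] with x hx hx'
    linarith [hx hx']
  intro η η1 η2 η3
  let k : ℝ → ℝ := fun x => η x - (∫ s, η s) * χ x
  have k1 : ContDiff ℝ ∞ k := η1.sub (contDiff_const.mul χ1)
  have k2 : HasCompactSupport k := η2.sub (χ2.mul_left (f := fun _ => ∫ s, η s))
  have k3 : tsupport k ⊆ Ioo 0 L := by
    refine (tsupport_sub η _).trans (union_subset η3 ?_)
    exact (tsupport_mul_subset_right (f := fun _ => ∫ s, η s) (g := χ)).trans χ3
  have hηi : Integrable η := η1.continuous.integrable_of_hasCompactSupport η2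
  have hχi : Integrable χ := χ1.continuous.integrable_of_hasCompactSupport χ2
  have k4 : ∫ x, k x = 0 := by
    rw [integral_sub hηi (hχi.const_mul _), integral_const_mul, χ4]
    simp
  have hki : Integrable k := k1.continuous.integrable_of_hasCompactSupport k2
  let ψ : ℝ → ℝ := fun x => ∫ s in (0 : ℝ)..x, k s
  have ψd (x : ℝ) : HasDerivAt ψ (k x) x :=
    intervalIntegral.integral_hasDerivAt_right (hki.intervalIntegrable)
      (k1.continuous.stronglyMeasurableAtFilter _ _) k1.continuous.continuousAt
  have ψderiv : deriv ψ = k := funext fun x => (ψd x).deriv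
  have ψ1 : ContDiff ℝ ∞ ψ := by
    rw [contDiff_infty_iff_deriv, ψderiv]
    exact ⟨fun x => (ψd x).differentiableAt, k1⟩
  have k0 : ∀ x, x ∉ tsupport k → k x = 0 := fun x hx => image_eq_zero_of_notMem_tsupport hx
  obtain ⟨a, b, hab0, hab⟩ : ∃ a b, Icc a b ⊆ Ioo 0 L ∧ tsupport k ⊆ Icc a b := by
    rcases (tsupport k).eq_empty_or_nonempty with he | hne
    · exact ⟨1, 0, by simp, by simp [he]⟩
    · obtain ⟨a, ha, ha'⟩ := k2.isCompact.exists_isLeast hne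
      obtain ⟨b, hb, hb'⟩ := k2.isCompact.exists_isGreatest hne
      refine ⟨a, b, ?_, fun x hx => ⟨ha' hx, hb' hx⟩⟩
      exact Icc_subset_Ioo (k3 ha).1 (k3 hb).2
  have ψ0 : ∀ x, x ∉ Icc a b → ψ x = 0 := by
    intro x hx
    by_cases hxb : x ≤ b
    · have hxa : x < a := by
        by_contra hcon
        exact hx ⟨not_lt.1 hcon, hxb⟩
      have : ∀ s ∈ uIcc 0 x, k s = 0 := by
        intro s hs
        apply k0
        intro hs'
        have h1 := hab hs'
        have h2 := k3 hs'
        rcases le_total 0 x with h0 | h0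
        · rw [uIcc_of_le h0] at hs
          linarith [h1.1, hs.2]
        · rw [uIcc_of_ge h0] at hs
          linarith [h2.1, hs.2]
      change ∫ s in (0 : ℝ)..x, k s = 0
      rw [intervalIntegral.integral_congr (g := fun _ => (0 : ℝ)) this]
      simp
    · have hxb' : b < x := not_le.1 hxb
      rw [← k4]
      change ∫ s in (0 : ℝ)..x, k s = _
      apply intervalIntegral.integral_eq_integral_of_support_subset
      intro s hs
      have hs' : s ∈ tsupport k := subset_tsupport _ hs
      exact ⟨(k3 hs').1, (hab hs').2.trans hxb'.le⟩
  have ψts : tsupport ψ ⊆ Icc a b := by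
    apply closure_minimal _ isClosed_Icc
    intro x hx
    by_contra hcon
    exact hx (ψ0 x hcon)
  have fin := h ψ ψ1 (HasCompactSupport.of_support_subset_isCompact isCompact_Icc
    ((subset_tsupport _).trans ψts)) (ψts.trans hab0)
  rw [ψderiv] at fin
  have e1 : ∫ x in Ioo 0 L, g x * k x
      = (∫ x in Ioo 0 L, g x * η x) - (∫ s, η s) * c := by
    rw [hc, ← integral_const_mul, ← integral_sub (int_mul η η1.continuous η2)
      ((int_mul χ χ1.continuous χ2).const_mul _)]
    congr 1
    ext x
    simp only [k]
    ring
  have e2 : ∫ x, η x • (g x - c) = ∫ x in Ioo 0 L, η x • (g x - c) := by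
    symm
    apply setIntegral_eq_integral_of_forall_compl_eq_zero
    intro x hx
    rw [image_eq_zero_of_notMem_tsupport (fun hx' => hx (η3 hx')), zero_smul]
  have e3 : ∫ x in Ioo 0 L, η x = ∫ x, η x := by
    apply setIntegral_eq_integral_of_forall_compl_eq_zero
    intro x hx
    exact image_eq_zero_of_notMem_tsupport (fun hx' => hx (η3 hx'))
  rw [e2]
  have e4 : ∫ x in Ioo 0 L, η x • (g x - c)
      = (∫ x in Ioo 0 L, g x * η x) - c * ∫ x in Ioo 0 L, η x := by
    rw [← integral_const_mul, ← integral_sub (int_mul η η1.continuous η2)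
      (hηi.integrableOn.const_mul _)]
    congr 1
    ext x
    simp only [smul_eq_mul]
    ring
  rw [e4, e3]
  linarith

/-- A weakly differentiable function on `(0, L)` agrees almost everywhere with a primitive of its
weak derivative. -/
theorem IsWeakDeriv.exists_ae_eq {L : ℝ} (hL : 0 < L) {φ w : H L} (h : IsWeakDeriv L φ w) :
    ∃ c : ℝ, ∀ᵐ x ∂(vol L), φ x = c + ∫ s in (0 : ℝ)..x, w s := by
  have hwi : IntervalIntegrable w volume 0 L := by
    rw [intervalIntegrable_iff_integrableOn_Ioo_of_le hL.le]
    exact w.integrableOn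
  let W : ℝ → ℝ := fun x => ∫ s in (0 : ℝ)..x, w s
  have hW : AbsolutelyContinuousOnInterval W 0 L :=
    hwi.absolutelyContinuousOnInterval_intervalIntegral (by simp)
  have hWc : ContinuousOn W (Icc 0 L) := by
    have := hW.continuousOn
    rwa [uIcc_of_le hL.le] at this
  have hWi : IntegrableOn W (Ioo 0 L) :=
    (hWc.integrableOn_compact isCompact_Icc).mono_set Ioo_subset_Icc_self
  obtain ⟨c, hc⟩ := ae_const_of_integral_mul_deriv hL (g := fun x => φ x - W x)
    (φ.integrableOn.sub hWi) (by
      intro ψ h1 h2 h3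
      have hd : Continuous (deriv ψ) := h1.continuous_deriv (by simp)
      have hψ0 : ψ 0 = 0 := image_eq_zero_of_notMem_tsupport (fun hx => lt_irrefl _ (h3 hx).1)
      have hψL : ψ L = 0 := image_eq_zero_of_notMem_tsupport (fun hx => lt_irrefl _ (h3 hx).2)
      have hψa : AbsolutelyContinuousOnInterval ψ 0 L :=
        (h1.of_le (by simp)).contDiffOn.absolutelyContinuousOnInterval
      have ibp := hW.integral_mul_deriv_eq_deriv_mul hψa
      rw [hψ0, hψL] at ibp
      have hWd : ∫ x in (0 : ℝ)..L, deriv W x * ψ x = ∫ x in (0 : ℝ)..L, w x * ψ x := by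
        apply intervalIntegral.integral_congr_ae
        filter_upwards [hwi.ae_hasDerivAt_integral] with x hx hx'
        rw [(hx (uIoc_subset_uIcc hx') 0 (by simp)).deriv]
      rw [hWd] at ibp
      simp only [intervalIntegral.integral_of_le hL.le, integral_Ioc_eq_integral_Ioo] at ibp
      have hWm : IntegrableOn (fun x => W x * deriv ψ x) (Ioo 0 L) :=
        ((hWc.mul hd.continuousOn).integrableOn_compact isCompact_Icc).mono_set
          Ioo_subset_Icc_self
      simp only [sub_mul]
      rw [integral_sub (φ.integrableOn_mul hd h2.deriv) hWm, h ψ h1 h2 h3, ibp]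
      ring)
  refine ⟨c, ?_⟩
  filter_upwards [hc] with x hx
  have : φ x - W x = c := hx
  change φ x = c + W x
  linarith

section

variable {L : ℝ} [hL : Fact (0 < L)]

instance instFactLe : Fact ((0 : ℝ) ≤ L) := ⟨hL.out.le⟩

/-- Every element of `V` has a unique representative that is continuous on `[0, L]`. -/
theorem existsUnique_contRep (φ : V L) :
    ∃! g : C(Icc (0 : ℝ) L, ℝ), φ.1.fst =ᵐ[vol L] IccExtend hL.out.le g := by
  obtain ⟨c, hc⟩ := IsWeakDeriv.exists_ae_eq hL.out φ.2
  have hwi : IntervalIntegrable φ.1.snd volume 0 L := by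
    rw [intervalIntegrable_iff_integrableOn_Ioo_of_le hL.out.le]
    exact φ.1.snd.integrableOn
  have hWc : ContinuousOn (fun x => c + ∫ s in (0 : ℝ)..x, φ.1.snd s) (Icc 0 L) := by
    have := (hwi.absolutelyContinuousOnInterval_intervalIntegral (c := 0) (by simp)).continuousOn
    rw [uIcc_of_le hL.out.le] at this
    exact continuousOn_const.add this
  refine ⟨⟨_, hWc.domRestrict⟩, ?_, ?_⟩
  · filter_upwards [hc, ae_restrict_mem measurableSet_Ioo] with x hx hx'
    rw [hx, IccExtend_of_mem _ _ (Ioo_subset_Icc_self hx')]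
    rfl
  · intro g hg
    have h1 : IccExtend hL.out.le g =ᵐ[vol L] fun x => c + ∫ s in (0 : ℝ)..x, φ.1.snd s :=
      hg.symm.trans hc
    have h2 : EqOn (IccExtend hL.out.le g) (fun x => c + ∫ s in (0 : ℝ)..x, φ.1.snd s)
        (Icc 0 L) := by
      have h3 : EqOn (IccExtend hL.out.le g) (fun x => c + ∫ s in (0 : ℝ)..x, φ.1.snd s)
          (Ioo 0 L) :=
        Measure.eqOn_open_of_ae_eq h1 isOpen_Ioo g.continuous.Icc_extend'.continuousOn
          (hWc.mono Ioo_subset_Icc_self)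
      refine h3.of_subset_closure g.continuous.Icc_extend'.continuousOn hWc
        Ioo_subset_Icc_self ?_
      rw [closure_Ioo hL.out.ne]
    ext x
    have := h2 x.2
    rw [IccExtend_of_mem _ _ x.2] at this
    exact this

/-- The embedding `V ↪ C([0, L])`: the continuous representative. The norm of `C([0, L])` is the
maximum norm. -/
def contRep (φ : V L) : C(Icc (0 : ℝ) L, ℝ) := (existsUnique_contRep φ).choose

theorem contRep_ae_eq (φ : V L) : φ.1.fst =ᵐ[vol L] IccExtend hL.out.le (contRep φ) :=
  (existsUnique_contRep φ).choose_spec.1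

theorem contRep_eq {φ : V L} {g : C(Icc (0 : ℝ) L, ℝ)}
    (h : φ.1.fst =ᵐ[vol L] IccExtend hL.out.le g) : contRep φ = g :=
  ((existsUnique_contRep φ).choose_spec.2 g h).symm

theorem contRep_zero : contRep (0 : V L) = 0 := by
  apply contRep_eq
  filter_upwards [Lp.coeFn_zero ℝ 2 (vol L)] with x hx
  simpa [IccExtend] using hx

theorem contRep_add (φ ψ : V L) : contRep (φ + ψ) = contRep φ + contRep ψ := by
  apply contRep_eq
  filter_upwards [Lp.coeFn_add φ.1.fst ψ.1.fst, contRep_ae_eq φ, contRep_ae_eq ψ] with x h h1 h2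
  change (φ.1.fst + ψ.1.fst : H L) x = _
  rw [h, Pi.add_apply, h1, h2]
  rfl

theorem contRep_smul (c : ℝ) (φ : V L) : contRep (c • φ) = c • contRep φ := by
  apply contRep_eq
  filter_upwards [Lp.coeFn_smul c φ.1.fst, contRep_ae_eq φ] with x h h1
  simp only [IccExtend, Function.comp_apply] at h1
  simp [IccExtend, h, h1]

variable (L) in
/-- The elements of `V` that vanish at `0`, as a subspace of `V`; here `⊥` is the left end point `0`
of `[0, L]`. -/
def V₀Submodule : Submodule ℝ (V L) where
  carrier := {φ | contRep φ ⊥ = 0}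
  zero_mem' := by simp [contRep_zero]
  add_mem' := by
    intro φ ψ h1 h2
    simp_all [contRep_add]
  smul_mem' := by
    intro c φ h
    simp_all [contRep_smul]

variable (L) in
/-- The space `V∘ = {φ ∈ V | φ(0) = 0}`; it carries its own inner product `∫ φ' ψ'`, not the one
inherited from `V`. -/
def V₀ : Type := V₀Submodule L

namespace V₀

instance : AddCommGroup (V₀ L) := inferInstanceAs (AddCommGroup (V₀Submodule L))

instance : Module ℝ (V₀ L) := inferInstanceAs (Module ℝ (V₀Submodule L))

/-- The inclusion of `V∘` in `V`. -/
def toV : V₀ L →ₗ[ℝ] V L := (V₀Submodule L).subtype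

/-- The underlying element of `L²(0, L)`. -/
def toH (φ : V₀ L) : H L := φ.toV.1.fst

/-- The weak derivative `φ' ∈ L²(0, L)`. -/
def wderiv (φ : V₀ L) : H L := φ.toV.1.snd

/-- The continuous representative of `φ`, as an element of `C([0, L])`. -/
def toC (φ : V₀ L) : C(Icc (0 : ℝ) L, ℝ) := contRep φ.toV

/-- The value of the continuous representative of `φ` at `x ∈ [0, L]`. -/
instance : CoeFun (V₀ L) (fun _ => ℝ → ℝ) := ⟨fun φ => IccExtend hL.out.le φ.toC⟩

theorem eq_zero_of_wderiv_eq_zero {φ : V₀ L} (h : φ.wderiv = 0) : φ = 0 := by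
  obtain ⟨c, hc⟩ := IsWeakDeriv.exists_ae_eq hL.out φ.toV.2
  have hw : ∀ x ∈ Ioo 0 L, ∫ s in (0 : ℝ)..x, φ.toV.1.snd s = 0 := by
    intro x hx
    have h0 : φ.toV.1.snd =ᵐ[vol L] 0 := by
      have : φ.toV.1.snd = 0 := h
      rw [this]
      exact Lp.coeFn_zero ℝ 2 (vol L)
    rw [intervalIntegral.integral_of_le hx.1.le,
      integral_congr_ae (g := fun _ => (0 : ℝ))]
    · simp
    · exact ae_restrict_of_ae_restrict_of_subset (t := Ioo 0 L)
        (fun s hs => ⟨hs.1, hs.2.trans_lt hx.2⟩) h0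
  have hcr : contRep φ.toV = ContinuousMap.const _ c := by
    apply contRep_eq
    filter_upwards [hc, ae_restrict_mem measurableSet_Ioo] with x hx hx'
    rw [hx, hw x hx']
    simp [IccExtend]
  have hc0 : c = 0 := by
    have : contRep φ.toV ⊥ = 0 := φ.2
    rw [hcr] at this
    exact this
  have hfst : φ.toV.1.fst = 0 := by
    apply Lp.ext
    filter_upwards [contRep_ae_eq φ.toV, Lp.coeFn_zero ℝ 2 (vol L)] with x hx hx'
    rw [hx, hcr, hc0, hx']
    simp [IccExtend]
  apply Subtype.ext
  apply Subtype.ext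
  apply (WithLp.equiv 2 (H L × H L)).injective
  exact Prod.ext hfst h

/-- The inner product `⟪φ, ψ⟫ = ∫ φ' ψ'` of `V∘`. -/
@[reducible]
def innerCore : InnerProductSpace.Core ℝ (V₀ L) where
  inner φ ψ := inner ℝ φ.wderiv ψ.wderiv
  conj_inner_symm φ ψ := inner_conj_symm (𝕜 := ℝ) φ.wderiv ψ.wderiv
  re_inner_nonneg φ := inner_self_nonneg (𝕜 := ℝ) (x := φ.wderiv)
  add_left φ ψ η := inner_add_left (𝕜 := ℝ) φ.wderiv ψ.wderiv η.wderiv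
  smul_left φ ψ r := inner_smul_left (𝕜 := ℝ) φ.wderiv ψ.wderiv r
  definite _ h := eq_zero_of_wderiv_eq_zero (inner_self_eq_zero (𝕜 := ℝ).1 h)

instance : NormedAddCommGroup (V₀ L) := innerCore.toNormedAddCommGroup

instance : InnerProductSpace ℝ (V₀ L) := InnerProductSpace.ofCore innerCore.toCore

theorem inner_eq (φ ψ : V₀ L) :
    inner ℝ φ ψ = ∫ x in Ioo 0 L, φ.wderiv x * ψ.wderiv x := by
  change inner ℝ φ.wderiv ψ.wderiv = _
  rw [L2.inner_def]
  simp [mul_comm]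

theorem norm_eq (φ : V₀ L) : ‖φ‖ = ‖φ.wderiv‖ := by
  rw [norm_eq_sqrt_real_inner φ, norm_eq_sqrt_real_inner φ.wderiv]
  rfl

end V₀

/-- `c` is a constant of the embedding `V ↪ C([0, L])`. -/
def IsEmbeddingConst (L : ℝ) [Fact (0 < L)] (c : ℝ) : Prop :=
  0 < c ∧ ∀ φ : V L, ‖contRep φ‖ ≤ c * ‖φ‖

/-- `c` is a constant in Poincaré's inequality `‖φ‖_H ≤ c ‖φ‖_{V∘}` on `V∘`. -/
def IsPoincareConst (L : ℝ) [Fact (0 < L)] (c : ℝ) : Prop :=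
  0 < c ∧ ∀ φ : V₀ L, ‖φ.toH‖ ≤ c * ‖φ‖

end

/-- The nonlinearity `f(y, q) = √y sinh q`. -/
def f (y q : ℝ) : ℝ := √y * Real.sinh q

/-- The set `𝒴_M` of functions `y ∈ C([0, T] × [0, L])` with values in `[1 / M, M]`. -/
def YM (T L M : ℝ) : Set (ℝ × ℝ → ℝ) :=
  {y | ContinuousOn y (Icc 0 T ×ˢ Icc 0 L) ∧
    ∀ t ∈ Icc 0 T, ∀ x ∈ Icc 0 L, 1 / M ≤ y (t, x) ∧ y (t, x) ≤ M}

/-- The admissible inputs: `u ∈ L²(0, T)` with `ua ≤ u ≤ ub` almost everywhere, for given bounds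
`ua, ub ∈ L^∞(0, T)`. -/
def Uad {T : ℝ} (ua ub : Lp ℝ ⊤ (vol T)) : Set (Lp ℝ 2 (vol T)) :=
  {u | ∀ᵐ t ∂(vol T), ua t ≤ u t ∧ u t ≤ ub t}

/-- The solution space `L^∞(0, T; V∘)`. -/
abbrev Q (T L : ℝ) [Fact (0 < L)] : Type := Lp (V₀ L) ⊤ (vol T)

/-- `q` is a weak solution of the problem `-μ₃ (κ₂ q_x)_x + μ₄ √y sinh q = 0` in `(0, L)`,
`q(t, 0) = 0`, `μ₃ κ₂(L) q_x(t, L) = u(t)`, for almost every `t ∈ (0, T)`. -/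
def IsWeakSolution {T L : ℝ} [Fact (0 < L)] (μ₃ μ₄ : ℝ) (κ₂ : ℝ → ℝ) (y : ℝ × ℝ → ℝ)
    (u : Lp ℝ 2 (vol T)) (q : Q T L) : Prop :=
  ∀ᵐ t ∂(vol T), ∀ φ : V₀ L,
    μ₃ * (∫ x in Ioo 0 L, κ₂ x * (q t).wderiv x * φ.wderiv x)
      + μ₄ * (∫ x in Ioo 0 L, f (y (t, x)) (q t x) * φ x) = u t * φ L

end Elliptic

end

/-!
For fixed `t` the weak formulation is an elliptic equation for `q(t) ∈ V∘` with a monotone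
nonlinearity, and time enters only as a parameter. With `J : V∘ → C([0, L])` the embedding,
`B q φ = μ₃ ∫ κ₂ q' φ'`, `I h = μ₄ ∫ h`, `z = √y(t, ·)` and `F φ = u(t) φ(L)`, the equation reads
`B q φ + I (z · sinh(J q) · J φ) = F φ`, see `isSemilinearSol_iff`. Here `B` is coercive with
constant `μ₃ κa`, and `I` is positive.

Since `sinh` is increasing, testing the difference of two solutions with itself yields the estimate
`IsSemilinearSol.norm_sub_le`, the source of all quantitative facts: uniqueness, the a priori bound
`‖q‖ ≤ ‖F‖ / (μ₃ κa)`, and continuity of the solution operator in `(z, F)`. For existence, `sinh` is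
truncated at a level above the a priori bound. The truncated problem is given by a strongly monotone
Lipschitz operator on a Hilbert space, hence is solvable by Banach's fixed point theorem
(`surjective_of_stronglyMonotone_of_lipschitz`), and its solution stays below the truncation level
(`exists_isSemilinearSol_sinh`).

The map `t ↦ q(t)` is the composition of the continuous solution operator with the strongly
measurable map `t ↦ (√y(t, ·), u(t) δ_L)`, where `δ_L` is the trace at `L`; so it is strongly
measurable, and the a priori bound puts it in `L^∞(0, T; V∘)`. As `‖δ_L‖ ≤ c_eP`, the constant
`c = c_eP ^ 2 / (μ₃ κa)`, taken at the lower bound of `μ₃`, serves for all data.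

The space `V∘` is complete because `φ ↦ φ'` is an isometry onto `L²(0, L)`
(`V₀.wderiv_surjective`). The embedding and Poincaré constants come from
`|φ(a) - φ(b)| ≤ √L ‖φ'‖` (`abs_contRep_sub_le`).
-/

noncomputable section

namespace Elliptic

/-! ### Monotone operators on a Hilbert space -/

/-- A strongly monotone Lipschitz map of a Hilbert space into itself is surjective (Zarantonello):
`x ↦ x - ρ (A x - b)` is a contraction for small `ρ`. -/
theorem surjective_of_stronglyMonotone_of_lipschitz {X : Type*} [NormedAddCommGroup X]
    [InnerProductSpace ℝ X] [CompleteSpace X] {A : X → X} {m Λ : ℝ} (hm : 0 < m)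
    (hmono : ∀ x y, m * ‖x - y‖ ^ 2 ≤ inner ℝ (A x - A y) (x - y))
    (hLip : ∀ x y, ‖A x - A y‖ ≤ Λ * ‖x - y‖) : Function.Surjective A := by
  intro b
  set Λ' := max Λ m with hΛ'
  have hmΛ : m ≤ Λ' := le_max_right _ _
  have hΛ : 0 < Λ' := hm.trans_le hmΛ
  have hLip' (x y : X) : ‖A x - A y‖ ≤ Λ' * ‖x - y‖ :=
    (hLip x y).trans (mul_le_mul_of_nonneg_right (le_max_left _ _) (norm_nonneg _))
  -- `ρ = m / Λ' ^ 2` minimises the squared contraction factor `1 - 2 ρ m + ρ ^ 2 Λ' ^ 2`.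
  set ρ := m / Λ' ^ 2 with hρ
  have hρ0 : 0 < ρ := by positivity
  have hρΛ : ρ * Λ' ^ 2 = m := by rw [hρ]; field_simp
  have hk0 : 0 ≤ 1 - ρ * m := by
    have : ρ * m ≤ 1 := by
      rw [hρ, div_mul_eq_mul_div, div_le_one (by positivity)]
      nlinarith
    linarith
  have hk1 : 1 - ρ * m < 1 := by
    have : 0 < ρ * m := by positivity
    linarith
  let Φ : X → X := fun x => x - ρ • (A x - b)
  have hΦ (x y : X) : ‖Φ x - Φ y‖ ≤ √(1 - ρ * m) * ‖x - y‖ := by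
    have e : Φ x - Φ y = (x - y) - ρ • (A x - A y) := by
      simp only [Φ, smul_sub]
      abel
    have hsq : ‖Φ x - Φ y‖ ^ 2 ≤ (√(1 - ρ * m) * ‖x - y‖) ^ 2 := by
      rw [mul_pow, Real.sq_sqrt hk0, e, norm_sub_sq_real, real_inner_smul_right, norm_smul,
        Real.norm_of_nonneg hρ0.le, real_inner_comm]
      have h1 := mul_le_mul_of_nonneg_left (hmono x y) hρ0.le
      have h2 : ‖A x - A y‖ ^ 2 ≤ Λ' ^ 2 * ‖x - y‖ ^ 2 := by
        rw [← mul_pow]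
        exact pow_le_pow_left₀ (norm_nonneg _) (hLip' x y) 2
      have h3 : (ρ * ‖A x - A y‖) ^ 2 ≤ ρ * m * ‖x - y‖ ^ 2 := by
        calc (ρ * ‖A x - A y‖) ^ 2 = ρ ^ 2 * ‖A x - A y‖ ^ 2 := by ring
          _ ≤ ρ ^ 2 * (Λ' ^ 2 * ‖x - y‖ ^ 2) := by gcongr
          _ = ρ * (ρ * Λ' ^ 2) * ‖x - y‖ ^ 2 := by ring
          _ = ρ * m * ‖x - y‖ ^ 2 := by rw [hρΛ]
      linarith
    exact (pow_le_pow_iff_left₀ (norm_nonneg _) (by positivity) two_ne_zero).1 hsq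
  have hc : ContractingWith (√(1 - ρ * m)).toNNReal Φ := by
    refine ⟨?_, LipschitzWith.of_dist_le_mul fun x y => ?_⟩
    · rw [Real.toNNReal_lt_one, Real.sqrt_lt' one_pos]
      simpa using hk1
    · rw [dist_eq_norm, dist_eq_norm, Real.coe_toNNReal _ (Real.sqrt_nonneg _)]
      exact hΦ x y
  have hfix : Φ (hc.fixedPoint Φ) = hc.fixedPoint Φ := hc.fixedPoint_isFixedPt
  refine ⟨hc.fixedPoint Φ, ?_⟩
  have h := sub_eq_self.1 hfix
  exact sub_eq_zero.1 ((smul_eq_zero.1 h).resolve_left hρ0.ne')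

/-! ### Semilinear equations with a monotone nonlinearity -/

/-- The hyperbolic sine as an element of `C(ℝ, ℝ)`. -/
def sinhC : C(ℝ, ℝ) := ⟨Real.sinh, Real.continuous_sinh⟩

/-- The hyperbolic sine, frozen outside `[-R, R]`. -/
def truncSinh (R : ℝ) : C(ℝ, ℝ) :=
  ⟨fun s => Real.sinh (max (-R) (min s R)), by fun_prop⟩

theorem truncSinh_apply_of_abs_le {R s : ℝ} (h : |s| ≤ R) : truncSinh R s = Real.sinh s := by
  rw [abs_le] at h
  simp [truncSinh, h.1, h.2]

theorem truncSinh_monotone (R : ℝ) : Monotone (truncSinh R) := fun _ _ h =>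
  Real.sinh_le_sinh.2 (max_le_max le_rfl (min_le_min h le_rfl))

theorem abs_truncSinh_sub_le {R : ℝ} (hR : 0 ≤ R) (s t : ℝ) :
    |truncSinh R s - truncSinh R t| ≤ Real.cosh R * |s - t| := by
  have hmem (r : ℝ) : max (-R) (min r R) ∈ Icc (-R) R :=
    ⟨le_max_left _ _, max_le (by linarith) (min_le_right _ _)⟩
  have h1 := (convex_Icc (-R) R).norm_image_sub_le_of_norm_deriv_le (f := Real.sinh)
    (C := Real.cosh R) (fun x _ => Real.differentiable_sinh x) (fun x hx => by
      rw [Real.deriv_sinh, Real.norm_eq_abs, abs_of_pos (Real.cosh_pos x), Real.cosh_le_cosh,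
        abs_of_nonneg hR]
      exact abs_le.2 hx) (hmem t) (hmem s)
  refine h1.trans (mul_le_mul_of_nonneg_left ?_ (Real.cosh_pos R).le)
  rw [Real.norm_eq_abs]
  refine (abs_max_sub_max_le_max _ _ _ _).trans ?_
  rw [sub_self, abs_zero]
  refine max_le (abs_nonneg _) ((abs_min_sub_min_le_max _ _ _ _).trans ?_)
  simp

section Semilinear

variable {X : Type*} [NormedAddCommGroup X] [InnerProductSpace ℝ X]
  {K : Type*} [TopologicalSpace K]

/-- `q` solves the semilinear equation `B q φ + I (z · g(J q) · J φ) = F φ` for all test functions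
`φ ∈ X`. The principal part `B` is a bilinear form on `X`; the superposition operator `q ↦ g(J q)`
acts in `C(K, ℝ)`, into which `X` is mapped by `J`, and `I` stands for integration. -/
def IsSemilinearSol (B : X →L[ℝ] X →L[ℝ] ℝ) (J : X →L[ℝ] C(K, ℝ)) (I : C(K, ℝ) →L[ℝ] ℝ)
    (g : C(ℝ, ℝ)) (z : C(K, ℝ)) (F : X →L[ℝ] ℝ) (q : X) : Prop :=
  ∀ φ, B q φ + I (z * g.comp (J q) * J φ) = F φ

variable {B : X →L[ℝ] X →L[ℝ] ℝ} {J : X →L[ℝ] C(K, ℝ)} {I : C(K, ℝ) →L[ℝ] ℝ}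
  {g : C(ℝ, ℝ)} {m : ℝ}

theorem nonneg_apply_mul_comp_sub (hI : ∀ h : C(K, ℝ), 0 ≤ h → 0 ≤ I h) (hg : Monotone g)
    {z : C(K, ℝ)} (hz : 0 ≤ z) (a b : C(K, ℝ)) :
    0 ≤ I (z * (g.comp a - g.comp b) * (a - b)) := by
  apply hI
  intro x
  have hzx : 0 ≤ z x := hz x
  change 0 ≤ z x * (g (a x) - g (b x)) * (a x - b x)
  rw [mul_assoc]
  apply mul_nonneg hzx
  rcases le_total (a x) (b x) with h | h
  · exact mul_nonneg_of_nonpos_of_nonpos (sub_nonpos.2 (hg h)) (sub_nonpos.2 h)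
  · exact mul_nonneg (sub_nonneg.2 (hg h)) (sub_nonneg.2 h)

variable [CompactSpace K]

/-- Solutions depend continuously on the coefficient `z` and the right-hand side `F`. For `z₁ = z₂`
this gives uniqueness, and for `q₂ = 0` the a priori bound. -/
theorem IsSemilinearSol.norm_sub_le (hB : ∀ x, m * ‖x‖ ^ 2 ≤ B x x)
    (hI : ∀ h : C(K, ℝ), 0 ≤ h → 0 ≤ I h) (hg : Monotone g)
    {z₁ z₂ : C(K, ℝ)} (hz : 0 ≤ z₁) {F₁ F₂ : X →L[ℝ] ℝ} {q₁ q₂ : X}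
    (h₁ : IsSemilinearSol B J I g z₁ F₁ q₁) (h₂ : IsSemilinearSol B J I g z₂ F₂ q₂) :
    m * ‖q₁ - q₂‖ ≤ ‖F₁ - F₂‖ + ‖I‖ * (‖z₁ - z₂‖ * ‖g.comp (J q₂)‖) * ‖J‖ := by
  set δ := q₁ - q₂ with hδ
  have e : B δ δ + I (z₁ * (g.comp (J q₁) - g.comp (J q₂)) * (J q₁ - J q₂))
      + I ((z₁ - z₂) * g.comp (J q₂) * J δ) = (F₁ - F₂) δ := by
    have e1 := h₁ δ
    have e2 := h₂ δ
    have e3 : z₁ * (g.comp (J q₁) - g.comp (J q₂)) * (J q₁ - J q₂)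
        + (z₁ - z₂) * g.comp (J q₂) * J δ
        = z₁ * g.comp (J q₁) * J δ - z₂ * g.comp (J q₂) * J δ := by
      rw [hδ, map_sub]
      ring
    have e4 : B δ δ = B q₁ δ - B q₂ δ := DFunLike.congr_fun (map_sub B q₁ q₂) δ
    rw [add_assoc, ← map_add, e3, map_sub I, sub_apply, ← e1, ← e2, e4]
    ring
  have h1 := hB δ
  have h2 := nonneg_apply_mul_comp_sub hI hg hz (J q₁) (J q₂)
  have h3 : (F₁ - F₂) δ ≤ ‖F₁ - F₂‖ * ‖δ‖ :=
    (le_abs_self _).trans ((F₁ - F₂).le_opNorm δ)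
  have h4 : -I ((z₁ - z₂) * g.comp (J q₂) * J δ)
      ≤ ‖I‖ * ((‖z₁ - z₂‖ * ‖g.comp (J q₂)‖) * (‖J‖ * ‖δ‖)) := by
    refine (neg_le_abs _).trans ((I.le_opNorm _).trans ?_)
    gcongr
    refine (norm_mul_le _ _).trans ?_
    gcongr
    · exact norm_mul_le _ _
    · exact J.le_opNorm δ
  have h5 : (m * ‖δ‖) * ‖δ‖
      ≤ (‖F₁ - F₂‖ + ‖I‖ * (‖z₁ - z₂‖ * ‖g.comp (J q₂)‖) * ‖J‖) * ‖δ‖ := by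
    linarith
  rcases (norm_nonneg δ).eq_or_lt with h | h
  · rw [← h, mul_zero]
    positivity
  · exact le_of_mul_le_mul_right h5 h

theorem IsSemilinearSol.norm_le (hB : ∀ x, m * ‖x‖ ^ 2 ≤ B x x)
    (hI : ∀ h : C(K, ℝ), 0 ≤ h → 0 ≤ I h) (hg : Monotone g) (hg0 : g 0 = 0)
    {z : C(K, ℝ)} (hz : 0 ≤ z) {F : X →L[ℝ] ℝ} {q : X} (h : IsSemilinearSol B J I g z F q) :
    m * ‖q‖ ≤ ‖F‖ := by
  have h0 : IsSemilinearSol B J I g z 0 0 := by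
    intro φ
    have : g.comp (J 0) = 0 := by
      ext x
      simp [hg0]
    rw [this]
    simp
  simpa using h.norm_sub_le hB hI hg hz h0

theorem exists_isSemilinearSol_of_lipschitz [CompleteSpace X] (hm : 0 < m)
    (hB : ∀ x, m * ‖x‖ ^ 2 ≤ B x x) (hI : ∀ h : C(K, ℝ), 0 ≤ h → 0 ≤ I h) (hg : Monotone g)
    {Λ : ℝ} (hΛ : 0 ≤ Λ) (hgL : ∀ s t, |g s - g t| ≤ Λ * |s - t|) {z : C(K, ℝ)} (hz : 0 ≤ z)
    (F : X →L[ℝ] ℝ) : ∃ q, IsSemilinearSol B J I g z F q := by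
  let N : X → (X →L[ℝ] ℝ) := fun q =>
    B q + I ∘L (ContinuousLinearMap.mul ℝ C(K, ℝ) (z * g.comp (J q))) ∘L J
  let A : X → X := fun q => (InnerProductSpace.toDual ℝ X).symm (N q)
  have hA (q φ : X) : inner ℝ (A q) φ = B q φ + I (z * g.comp (J q) * J φ) :=
    InnerProductSpace.toDual_symm_apply
  have hsub (q p φ : X) : inner ℝ (A q - A p) φ
      = B (q - p) φ + I (z * (g.comp (J q) - g.comp (J p)) * J φ) := by
    rw [inner_sub_left, hA, hA, mul_sub, sub_mul, map_sub I, map_sub B, sub_apply]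
    ring
  obtain ⟨q, hq⟩ := surjective_of_stronglyMonotone_of_lipschitz (A := A) (m := m)
    (Λ := ‖B‖ + ‖I‖ * (‖z‖ * (Λ * ‖J‖)) * ‖J‖) hm
    (by
      intro q p
      rw [hsub, map_sub J]
      have := nonneg_apply_mul_comp_sub hI hg hz (J q) (J p)
      linarith [hB (q - p)])
    (by
      intro q p
      have hcomp : ‖g.comp (J q) - g.comp (J p)‖ ≤ Λ * ‖J‖ * ‖q - p‖ := by
        rw [ContinuousMap.norm_le _ (by positivity)]
        intro x
        refine (hgL _ _).trans ?_
        rw [mul_assoc]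
        gcongr
        calc |J q x - J p x| = ‖J (q - p) x‖ := by simp
          _ ≤ ‖J (q - p)‖ := ContinuousMap.norm_coe_le_norm _ _
          _ ≤ ‖J‖ * ‖q - p‖ := J.le_opNorm _
      have key (φ : X) : inner ℝ (A q - A p) φ
          ≤ (‖B‖ + ‖I‖ * (‖z‖ * (Λ * ‖J‖)) * ‖J‖) * ‖q - p‖ * ‖φ‖ := by
        rw [hsub]
        have h1 : B (q - p) φ ≤ ‖B‖ * ‖q - p‖ * ‖φ‖ :=
          (le_abs_self _).trans (B.le_opNorm₂ _ _)
        have h2 : I (z * (g.comp (J q) - g.comp (J p)) * J φ)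
            ≤ ‖I‖ * ((‖z‖ * (Λ * ‖J‖ * ‖q - p‖)) * (‖J‖ * ‖φ‖)) := by
          refine (le_abs_self _).trans ((I.le_opNorm _).trans ?_)
          gcongr
          refine (norm_mul_le _ _).trans ?_
          gcongr
          · exact (norm_mul_le _ _).trans (by gcongr)
          · exact J.le_opNorm φ
        linarith
      have h := key (A q - A p)
      rw [real_inner_self_eq_norm_sq, sq] at h
      rcases (norm_nonneg (A q - A p)).eq_or_lt with h0 | h0
      · rw [← h0]
        positivity
      · exact le_of_mul_le_mul_right h h0)
    ((InnerProductSpace.toDual ℝ X).symm F)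
  refine ⟨q, fun φ => ?_⟩
  rw [← hA, hq, InnerProductSpace.toDual_symm_apply]

/-- Existence for the nonlinearity `sinh`. The solution for `sinh` truncated at a level above the a
priori bound never reaches the truncation. -/
theorem exists_isSemilinearSol_sinh [CompleteSpace X] (hm : 0 < m)
    (hB : ∀ x, m * ‖x‖ ^ 2 ≤ B x x) (hI : ∀ h : C(K, ℝ), 0 ≤ h → 0 ≤ I h)
    {z : C(K, ℝ)} (hz : 0 ≤ z) (F : X →L[ℝ] ℝ) : ∃ q, IsSemilinearSol B J I sinhC z F q := by
  set R := ‖J‖ * (‖F‖ / m) with hR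
  have hR0 : 0 ≤ R := by positivity
  obtain ⟨q, hq⟩ := exists_isSemilinearSol_of_lipschitz (J := J) hm hB hI (truncSinh_monotone R)
    (Real.cosh_pos R).le (abs_truncSinh_sub_le hR0) hz F
  have hqn := hq.norm_le hB hI (truncSinh_monotone R)
    (by rw [truncSinh_apply_of_abs_le (by simpa using hR0), Real.sinh_zero]) hz
  have hJq : ‖J q‖ ≤ R := by
    refine (J.le_opNorm q).trans ?_
    rw [hR]
    gcongr
    rwa [le_div_iff₀' hm]
  have e : (truncSinh R).comp (J q) = sinhC.comp (J q) := by
    ext x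
    exact truncSinh_apply_of_abs_le (((J q).norm_coe_le_norm x).trans hJq)
  refine ⟨q, fun φ => ?_⟩
  rw [← e]
  exact hq φ

theorem sinhC_monotone : Monotone sinhC := Real.sinh_strictMono.monotone

/-- The solution operator for the nonlinearity `sinh` is continuous. Taking the absolute value of
the coefficient makes it defined for all of `C(K, ℝ)`. -/
theorem continuous_of_isSemilinearSol_sinh (hm : 0 < m)
    (hB : ∀ x, m * ‖x‖ ^ 2 ≤ B x x) (hI : ∀ h : C(K, ℝ), 0 ≤ h → 0 ≤ I h)
    {S : C(K, ℝ) × (X →L[ℝ] ℝ) → X}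
    (hS : ∀ p, IsSemilinearSol B J I sinhC |p.1| p.2 (S p)) : Continuous S := by
  rw [continuous_iff_continuousAt]
  intro p
  have hle (r : C(K, ℝ) × (X →L[ℝ] ℝ)) : ‖S r - S p‖
      ≤ (‖r.2 - p.2‖ + ‖I‖ * (‖|r.1| - |p.1|‖ * ‖sinhC.comp (J (S p))‖) * ‖J‖) / m := by
    rw [le_div_iff₀' hm]
    exact (hS r).norm_sub_le hB hI sinhC_monotone (abs_nonneg _) (hS p)
  have hc : Continuous fun r : C(K, ℝ) × (X →L[ℝ] ℝ) =>
      (‖r.2 - p.2‖ + ‖I‖ * (‖|r.1| - |p.1|‖ * ‖sinhC.comp (J (S p))‖) * ‖J‖) / m := by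
    have habs : Continuous fun h : C(K, ℝ) => |h| :=
      ContinuousMap.continuous_postcomp ⟨fun s : ℝ => |s|, continuous_abs⟩
    have := habs.comp (continuous_fst (X := C(K, ℝ)) (Y := X →L[ℝ] ℝ))
    simp only [Function.comp_def] at this
    fun_prop
  rw [ContinuousAt, tendsto_iff_norm_sub_tendsto_zero]
  refine squeeze_zero (fun _ => norm_nonneg _) hle ?_
  have := hc.tendsto p
  simpa using this

end Semilinear

/-! ### The spaces `V` and `V∘` -/

section Spaces

variable {L : ℝ} [hL : Fact (0 < L)]

theorem H.integral_abs_le (w : H L) : ∫ x in Ioo 0 L, |w x| ≤ √L * ‖w‖ := by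
  have h := L2.inner_indicatorConstLp_one (𝕜 := ℝ) (μ := vol L) MeasurableSet.univ
    (measure_ne_top _ _) |w|
  rw [setIntegral_univ, integral_congr_ae (Lp.coeFn_abs w)] at h
  rw [← h]
  refine (real_inner_le_norm _ _).trans_eq ?_
  rw [norm_indicatorConstLp two_ne_zero (by simp), norm_abs_eq_norm]
  simp [Real.sqrt_eq_rpow, hL.out.le, measureReal_def]

theorem H.intervalIntegrable (w : H L) : IntervalIntegrable w volume 0 L := by
  rw [intervalIntegrable_iff_integrableOn_Ioo_of_le hL.out.le]
  exact w.integrableOn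

/-- The primitive of an element of `L²(0, L)` that vanishes at `0`, as an element of
`C([0, L])`. -/
def primitive (w : H L) : C(Icc (0 : ℝ) L, ℝ) where
  toFun x := ∫ s in (0 : ℝ)..x, w s
  continuous_toFun := by
    have := (w.intervalIntegrable.absolutelyContinuousOnInterval_intervalIntegral
      (c := 0) (by simp)).continuousOn
    rw [uIcc_of_le hL.out.le] at this
    exact this.domRestrict

theorem exists_contRep_eq_const_add_primitive (φ : V L) :
    ∃ c : ℝ, contRep φ = ContinuousMap.const _ c + primitive φ.1.snd := by
  obtain ⟨c, hc⟩ := IsWeakDeriv.exists_ae_eq hL.out φ.2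
  refine ⟨c, contRep_eq ?_⟩
  filter_upwards [hc, ae_restrict_mem measurableSet_Ioo] with x hx hx'
  rw [hx, IccExtend_of_mem _ _ (Ioo_subset_Icc_self hx')]
  rfl

theorem abs_contRep_sub_le (φ : V L) (a b : Icc (0 : ℝ) L) :
    |contRep φ a - contRep φ b| ≤ √L * ‖φ.1.snd‖ := by
  obtain ⟨c, hc⟩ := exists_contRep_eq_const_add_primitive φ
  have hi (x : Icc (0 : ℝ) L) : IntervalIntegrable φ.1.snd volume 0 x :=
    (H.intervalIntegrable φ.1.snd).mono_set
      (uIcc_subset_uIcc left_mem_uIcc (by rw [uIcc_of_le hL.out.le]; exact x.2))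
  have e : contRep φ a - contRep φ b = ∫ s in (b : ℝ)..a, φ.1.snd s := by
    rw [hc, ← intervalIntegral.integral_interval_sub_left (hi a) (hi b)]
    exact add_sub_add_left_eq_sub _ _ c
  rw [e, ← Real.norm_eq_abs]
  refine (intervalIntegral.norm_integral_le_integral_norm_uIoc (μ := volume)).trans ?_
  have hsub : uIoc (b : ℝ) a ⊆ Ioc 0 L := fun s hs =>
    ⟨(le_min b.2.1 a.2.1).trans_lt hs.1, hs.2.trans (max_le b.2.2 a.2.2)⟩
  refine le_trans ?_ (H.integral_abs_le φ.1.snd)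
  rw [← integral_Ioc_eq_integral_Ioo]
  refine setIntegral_mono_set ?_ (ae_of_all _ fun s => abs_nonneg _) hsub.eventuallyLE
  have := (H.intervalIntegrable φ.1.snd).norm
  rwa [intervalIntegrable_iff_integrableOn_Ioc_of_le hL.out.le] at this

/-- The supremum of `|φ|` exceeds its mean by at most the oscillation `√L ‖φ'‖`. -/
theorem exists_isEmbeddingConst : ∃ c, IsEmbeddingConst L c := by
  have hL0 := hL.out
  refine ⟨(√L + L * √L) / L, by positivity, fun φ => ?_⟩
  rw [ContinuousMap.norm_le _ (by positivity)]
  intro x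
  rw [div_mul_eq_mul_div, le_div_iff₀' hL0]
  have h1 : ‖φ.1.fst‖ ≤ ‖φ‖ := WithLp.norm_fst_le _ φ.1
  have h2 : ‖φ.1.snd‖ ≤ ‖φ‖ := WithLp.norm_snd_le _ φ.1
  have hae : ∀ᵐ s ∂(vol L), |contRep φ x| ≤ |φ.1.fst s| + √L * ‖φ.1.snd‖ := by
    filter_upwards [contRep_ae_eq φ, ae_restrict_mem measurableSet_Ioo] with s hs hs'
    rw [hs, IccExtend_of_mem _ _ (Ioo_subset_Icc_self hs')]
    have := abs_contRep_sub_le φ x ⟨s, Ioo_subset_Icc_self hs'⟩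
    have h3 := abs_sub_abs_le_abs_sub (contRep φ x) (contRep φ ⟨s, Ioo_subset_Icc_self hs'⟩)
    linarith
  have hint := integral_mono_ae (integrable_const _)
    ((H.integrableOn φ.1.fst).abs.add (integrable_const _)) hae
  rw [integral_add' (H.integrableOn φ.1.fst).abs (integrable_const _)] at hint
  simp only [integral_const, measureReal_restrict_apply_univ, Real.volume_real_Ioo_of_le hL0.le,
    sub_zero, smul_eq_mul] at hint
  have h4 := H.integral_abs_le φ.1.fst
  rw [Real.norm_eq_abs]
  calc L * |contRep φ x| ≤ √L * ‖φ.1.fst‖ + L * (√L * ‖φ.1.snd‖) := by linarith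
    _ ≤ √L * ‖φ‖ + L * (√L * ‖φ‖) := by gcongr
    _ = (√L + L * √L) * ‖φ‖ := by ring

namespace V₀

theorem norm_toC_le (φ : V₀ L) : ‖φ.toC‖ ≤ √L * ‖φ‖ := by
  rw [ContinuousMap.norm_le _ (by positivity)]
  intro x
  have h := abs_contRep_sub_le φ.toV x ⊥
  have h0 : contRep φ.toV ⊥ = 0 := φ.2
  rw [h0, sub_zero] at h
  rw [norm_eq]
  exact h

theorem coeFn_toH (φ : V₀ L) : φ.toH =ᵐ[vol L] φ := contRep_ae_eq φ.toV

theorem abs_apply_le (φ : V₀ L) (x : ℝ) : |φ x| ≤ ‖φ.toC‖ :=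
  φ.toC.norm_coe_le_norm (projIcc 0 L hL.out.le x)

end V₀

theorem exists_isPoincareConst : ∃ c, IsPoincareConst L c := by
  set C : ℝ := (measureUnivNNReal (vol L) : ℝ) ^ (2 : ENNReal).toReal⁻¹ * √L with hC
  have hC0 : 0 ≤ C := by positivity
  refine ⟨C + 1, by positivity, fun φ => ?_⟩
  have h : ‖φ.toH‖ ≤ (measureUnivNNReal (vol L) : ℝ) ^ (2 : ENNReal).toReal⁻¹ * (√L * ‖φ‖) := by
    refine Lp.norm_le_of_ae_bound (by positivity) ?_
    filter_upwards [φ.coeFn_toH] with x hx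
    rw [hx]
    exact (φ.abs_apply_le x).trans φ.norm_toC_le
  have : 0 ≤ ‖φ‖ := norm_nonneg φ
  rw [← mul_assoc] at h
  linarith

namespace V₀

theorem norm_toC_le_of_const {ce cP : ℝ} (he : IsEmbeddingConst L ce) (hP : IsPoincareConst L cP)
    (φ : V₀ L) : ‖φ.toC‖ ≤ ce * √(cP ^ 2 + 1) * ‖φ‖ := by
  refine (he.2 φ.toV).trans ?_
  rw [mul_assoc]
  refine mul_le_mul_of_nonneg_left ?_ he.1.le
  have e : ‖φ.toV‖ = √(‖φ.toH‖ ^ 2 + ‖φ.wderiv‖ ^ 2) := WithLp.prod_norm_eq_of_L2 φ.toV.1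
  rw [e, ← norm_eq, Real.sqrt_le_iff]
  refine ⟨by positivity, ?_⟩
  rw [mul_pow, Real.sq_sqrt (by positivity), add_mul, one_mul, ← mul_pow]
  gcongr
  exact hP.2 φ

/-- The weak derivative as a linear isometry of `V∘` into `L²(0, L)`. -/
def wderivₗᵢ : V₀ L →ₗᵢ[ℝ] H L where
  toFun := wderiv
  map_add' _ _ := rfl
  map_smul' _ _ := rfl
  norm_map' φ := (norm_eq φ).symm

/-- Every `w ∈ L²(0, L)` is the weak derivative of its primitive. -/
theorem wderiv_surjective : Function.Surjective (wderiv : V₀ L → H L) := by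
  intro w
  have hwi := w.intervalIntegrable
  let W : ℝ → ℝ := fun x => ∫ s in (0 : ℝ)..x, w s
  have hW : AbsolutelyContinuousOnInterval W 0 L :=
    hwi.absolutelyContinuousOnInterval_intervalIntegral (by simp)
  have hPm : MemLp (IccExtend hL.out.le (primitive w)) 2 (vol L) :=
    MemLp.of_bound (primitive w).continuous.Icc_extend'.aestronglyMeasurable ‖primitive w‖
      (ae_of_all _ fun x => (primitive w).norm_coe_le_norm _)
  have hPW : ∀ x ∈ Icc 0 L, IccExtend hL.out.le (primitive w) x = W x := fun x hx =>
    IccExtend_of_mem _ _ hx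
  have hwd : IsWeakDeriv L (hPm.toLp _ : H L) w := by
    intro ψ h1 h2 h3
    have hψ0 : ψ 0 = 0 := image_eq_zero_of_notMem_tsupport (fun hx => lt_irrefl _ (h3 hx).1)
    have hψL : ψ L = 0 := image_eq_zero_of_notMem_tsupport (fun hx => lt_irrefl _ (h3 hx).2)
    have hψa : AbsolutelyContinuousOnInterval ψ 0 L :=
      (h1.of_le (by simp)).contDiffOn.absolutelyContinuousOnInterval
    have ibp := hW.integral_mul_deriv_eq_deriv_mul hψa
    rw [hψ0, hψL] at ibp
    have hWd : ∫ x in (0 : ℝ)..L, deriv W x * ψ x = ∫ x in (0 : ℝ)..L, w x * ψ x := by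
      apply intervalIntegral.integral_congr_ae
      filter_upwards [hwi.ae_hasDerivAt_integral] with x hx hx'
      rw [(hx (uIoc_subset_uIcc hx') 0 (by simp)).deriv]
    rw [hWd] at ibp
    simp only [intervalIntegral.integral_of_le hL.out.le, integral_Ioc_eq_integral_Ioo] at ibp
    have e : ∫ x in Ioo 0 L, (hPm.toLp _ : H L) x * deriv ψ x
        = ∫ x in Ioo 0 L, W x * deriv ψ x := by
      apply integral_congr_ae
      filter_upwards [hPm.coeFn_toLp, ae_restrict_mem measurableSet_Ioo] with x hx hx'
      rw [hx, hPW x (Ioo_subset_Icc_self hx')]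
    rw [e, ibp]
    ring
  let p : V L := ⟨WithLp.toLp 2 ((hPm.toLp _ : H L), w), hwd⟩
  have hp : contRep p = primitive w := contRep_eq hPm.coeFn_toLp
  have hp0 : contRep p ⊥ = 0 := by
    rw [hp]
    exact intervalIntegral.integral_same
  exact ⟨⟨p, hp0⟩, rfl⟩

instance : CompleteSpace (V₀ L) :=
  ((wderivₗᵢ (L := L)).isometry.isUniformInducing.completeSpace_congr wderiv_surjective).2
    inferInstance

/-- The embedding of `V∘` in `C([0, L])` as a continuous linear map. -/
def toCL : V₀ L →L[ℝ] C(Icc (0 : ℝ) L, ℝ) :=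
  LinearMap.mkContinuous
    { toFun := toC
      map_add' := fun φ ψ => contRep_add φ.toV ψ.toV
      map_smul' := fun c φ => contRep_smul c φ.toV } √L norm_toC_le

end V₀

/-! ### The terms of the weak formulation -/

variable (L) in
/-- The functional `h ↦ ∫ h` on `C([0, L])`. -/
def integralCL : C(Icc (0 : ℝ) L, ℝ) →L[ℝ] ℝ :=
  have hint (h : C(Icc (0 : ℝ) L, ℝ)) : Integrable (IccExtend hL.out.le h) (vol L) :=
    h.continuous.Icc_extend'.continuousOn.integrableOn_Icc.mono_set Ioo_subset_Icc_self
  LinearMap.mkContinuous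
    { toFun := fun h => ∫ x in Ioo 0 L, IccExtend hL.out.le h x
      map_add' := fun g h => integral_add (hint g) (hint h)
      map_smul' := fun c h => integral_const_mul c (IccExtend hL.out.le h) } L (fun h => by
        have := norm_integral_le_of_norm_le_const (μ := vol L) (C := ‖h‖)
          (ae_of_all _ fun x => h.norm_coe_le_norm (projIcc 0 L hL.out.le x))
        rw [measureReal_restrict_apply_univ, Real.volume_real_Ioo_of_le hL.out.le, sub_zero,
          mul_comm] at this
        exact this)

theorem integralCL_nonneg (h : C(Icc (0 : ℝ) L, ℝ)) (hh : 0 ≤ h) : 0 ≤ integralCL L h :=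
  integral_nonneg fun x => hh (projIcc 0 L hL.out.le x)

/-- The bilinear form `∫ κ q' φ'` is bounded on `V∘` and inherits its coercivity from the lower
bound of the coefficient `κ`. -/
theorem exists_bilin {κ : ℝ → ℝ} {κa : ℝ} (hκc : ContinuousOn κ (Icc 0 L))
    (hκ : ∀ x ∈ Icc 0 L, κa ≤ κ x) : ∃ B : V₀ L →L[ℝ] V₀ L →L[ℝ] ℝ,
      (∀ q φ, B q φ = ∫ x in Ioo 0 L, κ x * q.wderiv x * φ.wderiv x) ∧
      ∀ q, κa * ‖q‖ ^ 2 ≤ B q q := by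
  obtain ⟨C, hC⟩ := isCompact_Icc.exists_bound_of_continuousOn hκc
  have hCae : ∀ᵐ x ∂(vol L), ‖κ x‖ ≤ C := by
    filter_upwards [ae_restrict_mem measurableSet_Ioo] with x hx
    exact hC x (Ioo_subset_Icc_self hx)
  have hC0 : 0 ≤ C := (norm_nonneg _).trans (hC 0 ⟨le_rfl, hL.out.le⟩)
  have hκm : AEStronglyMeasurable κ (vol L) :=
    (hκc.mono Ioo_subset_Icc_self).aestronglyMeasurable measurableSet_Ioo
  have hwv (w v : H L) : Integrable (fun x => w x * v x) (vol L) :=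
    (Lp.memLp w).integrable_mul (Lp.memLp v)
  have hint (w v : H L) : Integrable (fun x => κ x * w x * v x) (vol L) := by
    simp only [mul_assoc]
    exact (hwv w v).bdd_mul hκm hCae
  have hinner (w v : H L) : ∫ x in Ioo 0 L, w x * v x = inner ℝ w v := by
    rw [L2.inner_def]
    simp [mul_comm]
  let b : V₀ L →ₗ[ℝ] V₀ L →ₗ[ℝ] ℝ := LinearMap.mk₂ ℝ
    (fun q φ => ∫ x in Ioo 0 L, κ x * q.wderiv x * φ.wderiv x)
    (by
      intro q p φ
      rw [← integral_add (hint _ _) (hint _ _)]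
      apply integral_congr_ae
      filter_upwards [Lp.coeFn_add q.wderiv p.wderiv] with x hx
      change κ x * (q.wderiv + p.wderiv : H L) x * _ = _
      rw [hx, Pi.add_apply]
      ring)
    (by
      intro c q φ
      rw [smul_eq_mul, ← integral_const_mul]
      apply integral_congr_ae
      filter_upwards [Lp.coeFn_smul c q.wderiv] with x hx
      change κ x * (c • q.wderiv : H L) x * _ = _
      rw [hx, Pi.smul_apply, smul_eq_mul]
      ring)
    (by
      intro φ q p
      rw [← integral_add (hint _ _) (hint _ _)]
      apply integral_congr_ae
      filter_upwards [Lp.coeFn_add q.wderiv p.wderiv] with x hx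
      change κ x * _ * (q.wderiv + p.wderiv : H L) x = _
      rw [hx, Pi.add_apply]
      ring)
    (by
      intro c φ q
      rw [smul_eq_mul, ← integral_const_mul]
      apply integral_congr_ae
      filter_upwards [Lp.coeFn_smul c q.wderiv] with x hx
      change κ x * _ * (c • q.wderiv : H L) x = _
      rw [hx, Pi.smul_apply, smul_eq_mul]
      ring)
  refine ⟨b.mkContinuous₂ C ?_, fun q φ => rfl, ?_⟩
  · intro q φ
    have h1 : ‖b q φ‖ ≤ ∫ x in Ioo 0 L, C * (|q.wderiv| x * |φ.wderiv| x) := by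
      refine norm_integral_le_of_norm_le ((hwv _ _).const_mul C) ?_
      filter_upwards [hCae, Lp.coeFn_abs q.wderiv, Lp.coeFn_abs φ.wderiv] with x h h2 h3
      rw [h2, h3, norm_mul, norm_mul, mul_assoc]
      exact mul_le_mul_of_nonneg_right h (by positivity)
    rw [integral_const_mul, hinner] at h1
    refine h1.trans ?_
    rw [mul_assoc, V₀.norm_eq q, V₀.norm_eq φ, ← norm_abs_eq_norm q.wderiv,
      ← norm_abs_eq_norm φ.wderiv]
    gcongr
    exact real_inner_le_norm _ _
  · intro q
    rw [← real_inner_self_eq_norm_sq, V₀.inner_eq, ← integral_const_mul]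
    refine integral_mono_ae ((hwv _ _).const_mul _) (hint _ _) ?_
    filter_upwards [ae_restrict_mem measurableSet_Ioo] with x hx
    simp only [mul_assoc]
    exact mul_le_mul_of_nonneg_right (hκ x (Ioo_subset_Icc_self hx)) (mul_self_nonneg _)

end Spaces

/-! ### The weak formulation as a semilinear equation -/

/-- The function `√y(t, ·) ∈ C([0, L])`, extended continuously from `[0, T]` to all times
`t` so that its strong measurability in `t` is immediate. -/
theorem exists_continuous_sqrt_slice {T L : ℝ} (hT : 0 ≤ T) {y : ℝ × ℝ → ℝ}
    (hy : ContinuousOn y (Icc 0 T ×ˢ Icc 0 L)) :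
    ∃ Z : ℝ → C(Icc (0 : ℝ) L, ℝ), Continuous Z ∧ (∀ t, 0 ≤ Z t) ∧
      ∀ t ∈ Icc 0 T, ∀ x : Icc (0 : ℝ) L, Z t x = √(y (t, x)) := by
  have hc : Continuous fun p : ℝ × Icc (0 : ℝ) L => √(y (projIcc 0 T hT p.1, p.2)) := by
    refine (hy.comp_continuous (f := fun p : ℝ × Icc (0 : ℝ) L =>
      ((projIcc 0 T hT p.1 : ℝ), (p.2 : ℝ))) ?_ fun p => ⟨(projIcc 0 T hT p.1).2, p.2.2⟩).sqrt
    have : Continuous (projIcc 0 T hT) := continuous_projIcc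
    fun_prop
  refine ⟨(ContinuousMap.mk _ hc).curry, (ContinuousMap.mk _ hc).curry.continuous,
    fun t x => Real.sqrt_nonneg _, fun t ht x => ?_⟩
  change √(y (projIcc 0 T hT t, x)) = _
  rw [projIcc_of_mem hT ht]

section WeakForm

variable {L : ℝ} [hL : Fact (0 < L)]

variable (L) in
/-- The trace functional `φ ↦ φ(L)` on `V∘`; here `⊤` is the right end point `L` of `[0, L]`. -/
def traceCL : V₀ L →L[ℝ] ℝ := (ContinuousMap.evalCLM ℝ (⊤ : Icc (0 : ℝ) L)) ∘L V₀.toCL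

theorem traceCL_apply (φ : V₀ L) : traceCL L φ = φ L :=
  congrArg φ.toC (projIcc_right (h := hL.out.le)).symm

theorem isSemilinearSol_iff {B : V₀ L →L[ℝ] V₀ L →L[ℝ] ℝ} {κ : ℝ → ℝ}
    (hB : ∀ q φ, B q φ = ∫ x in Ioo 0 L, κ x * q.wderiv x * φ.wderiv x) {μ₃ μ₄ u : ℝ}
    {z : C(Icc (0 : ℝ) L, ℝ)} {y : ℝ → ℝ} (hz : ∀ x : Icc (0 : ℝ) L, z x = √(y x))
    {q : V₀ L} :
    IsSemilinearSol (μ₃ • B) V₀.toCL (μ₄ • integralCL L) sinhC z (u • traceCL L) q ↔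
      ∀ φ : V₀ L, μ₃ * (∫ x in Ioo 0 L, κ x * q.wderiv x * φ.wderiv x)
        + μ₄ * (∫ x in Ioo 0 L, f (y x) (q x) * φ x) = u * φ L := by
  refine forall_congr' fun φ => ?_
  have e : integralCL L (z * sinhC.comp (V₀.toCL q) * V₀.toCL φ)
      = ∫ x in Ioo 0 L, f (y x) (q x) * φ x := by
    refine setIntegral_congr_fun measurableSet_Ioo fun x hx => ?_
    have hzx : IccExtend hL.out.le z x = √(y x) := by
      rw [IccExtend_of_mem _ _ (Ioo_subset_Icc_self hx)]
      exact hz _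
    rw [f, ← hzx]
    rfl
  simp only [smul_apply, smul_eq_mul, hB, e, traceCL_apply]

end WeakForm

/-! ### Solutions in `L^∞(0, T; V∘)` -/

theorem ae_norm_le_norm {α E : Type*} [MeasurableSpace α] {μ : Measure α} [NormedAddCommGroup E]
    (h : Lp E ⊤ μ) : ∀ᵐ t ∂μ, ‖h t‖ ≤ ‖h‖ := by
  filter_upwards [enorm_ae_le_eLpNormEssSup h μ] with t ht
  rwa [← eLpNorm_exponent_top, ← Lp.enorm_def, enorm_le_iff_norm_le] at ht

theorem ae_abs_le_of_mem_Uad {T : ℝ} {ua ub : Lp ℝ ⊤ (vol T)} {u : Lp ℝ 2 (vol T)}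
    (hu : u ∈ Uad ua ub) : ∀ᵐ t ∂(vol T), |u t| ≤ max ‖ua‖ ‖ub‖ := by
  filter_upwards [hu, ae_norm_le_norm ua, ae_norm_le_norm ub] with t h ha hb
  exact (abs_le_max_abs_abs h.1 h.2).trans (max_le_max ha hb)

end Elliptic

end

open Elliptic in
theorem mainTheorem2
    (T L : ℝ) (hT : 0 < T) [hL : Fact (0 < L)]
    (κ₂ : ℝ → ℝ) (κa : ℝ) (hκa : 0 < κa)
    (hκLip : ∃ K, LipschitzOnWith K κ₂ (Set.Icc 0 L)) (hκ : ∀ x ∈ Set.Icc 0 L, κa ≤ κ₂ x)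
    (μa μb : Fin 4 → ℝ) (hμa : ∀ i, 0 < μa i) (hμab : μa ≤ μb)
    (M : ℝ) (hM : 1 < M) :
    (∃ ce, Elliptic.IsEmbeddingConst L ce) ∧ (∃ cP, Elliptic.IsPoincareConst L cP) ∧
    ∀ ce cP : ℝ, Elliptic.IsEmbeddingConst L ce → Elliptic.IsPoincareConst L cP →
      ∃ c : ℝ, 0 < c ∧
        ∀ μ ∈ Set.Icc μa μb, ∀ y ∈ Elliptic.YM T L M,
        ∀ ua ub : MeasureTheory.Lp ℝ ⊤ (Elliptic.vol T), ua ≤ ub →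
        ∀ u ∈ Elliptic.Uad ua ub,
          (∃! q : Elliptic.Q T L, Elliptic.IsWeakSolution (μ 2) (μ 3) κ₂ y u q) ∧
          ∀ q : Elliptic.Q T L, Elliptic.IsWeakSolution (μ 2) (μ 3) κ₂ y u q →
            ∀ᵐ t ∂(Elliptic.vol T),
              ‖(q t).toC‖ ≤ ce * √(cP ^ 2 + 1) * ‖q t‖ ∧
              ce * √(cP ^ 2 + 1) * ‖q t‖ ≤ c * |u t| ∧
              c * |u t| ≤ c * max ‖ua‖ ‖ub‖ := by
  refine ⟨exists_isEmbeddingConst, exists_isPoincareConst, fun ce cP he hP => ?_⟩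
  obtain ⟨K, hK⟩ := hκLip
  obtain ⟨B, hB, hBκ⟩ := exists_bilin hK.continuousOn hκ
  have hce : 0 < ce := he.1
  set ceP := ce * √(cP ^ 2 + 1) with hceP
  have hceP0 : 0 < ceP := by positivity
  have hμa2 : 0 < μa 2 := hμa 2
  refine ⟨ceP * (ceP / (μa 2 * κa)), by positivity, fun μ hμ y hy ua ub _ u hu => ?_⟩
  have hμ2 : μa 2 ≤ μ 2 := hμ.1 2
  have hμ3 : 0 < μ 3 := (hμa 3).trans_le (hμ.1 3)
  have hm : 0 < μa 2 * κa := by positivity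
  obtain ⟨Z, hZc, hZ0, hZ⟩ := exists_continuous_sqrt_slice (L := L) hT.le hy.1
  -- The abstract setting: coercivity with the constant `μa 2 * κa`, and positivity of the integral.
  have hBm (q : V₀ L) : μa 2 * κa * ‖q‖ ^ 2 ≤ (μ 2 • B) q q := by
    calc μa 2 * κa * ‖q‖ ^ 2 ≤ μ 2 * (κa * ‖q‖ ^ 2) := by rw [mul_assoc]; gcongr
      _ ≤ μ 2 * B q q := mul_le_mul_of_nonneg_left (hBκ q) (hμa2.le.trans hμ2)
  have hI (h : C(Icc (0 : ℝ) L, ℝ)) (hh : 0 ≤ h) : 0 ≤ (μ 3 • integralCL L) h :=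
    mul_nonneg hμ3.le (integralCL_nonneg h hh)
  have htr (s : ℝ) : ‖s • traceCL L‖ ≤ ceP * |s| := by
    refine ContinuousLinearMap.opNorm_le_bound _ (by positivity) fun φ => ?_
    have h : ‖φ.toC ⊤‖ ≤ ceP * ‖φ‖ :=
      (φ.toC.norm_coe_le_norm _).trans (V₀.norm_toC_le_of_const he hP φ)
    calc ‖s * φ.toC ⊤‖ = |s| * ‖φ.toC ⊤‖ := norm_mul _ _
      _ ≤ |s| * (ceP * ‖φ‖) := by gcongr
      _ = ceP * |s| * ‖φ‖ := by ring
  have hbound {z : C(Icc (0 : ℝ) L, ℝ)} (hz : 0 ≤ z) {s : ℝ} {q : V₀ L}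
      (hq : IsSemilinearSol (μ 2 • B) V₀.toCL (μ 3 • integralCL L) sinhC z (s • traceCL L) q) :
      ‖q‖ ≤ ceP / (μa 2 * κa) * |s| := by
    rw [div_mul_eq_mul_div, le_div_iff₀' hm]
    exact (hq.norm_le hBm hI sinhC_monotone Real.sinh_zero hz).trans (htr s)
  have hsol (q : Q T L) : IsWeakSolution (μ 2) (μ 3) κ₂ y u q ↔ ∀ᵐ t ∂(vol T),
      IsSemilinearSol (μ 2 • B) V₀.toCL (μ 3 • integralCL L) sinhC (Z t)
        (u t • traceCL L) (q t) := by
    refine eventually_congr ?_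
    filter_upwards [ae_restrict_mem measurableSet_Ioo] with t ht
    exact (isSemilinearSol_iff hB (hZ t (Ioo_subset_Icc_self ht))).symm
  refine ⟨?_, fun q hq => ?_⟩
  · choose S hS using fun p : C(Icc (0 : ℝ) L, ℝ) × (V₀ L →L[ℝ] ℝ) =>
      exists_isSemilinearSol_sinh (J := V₀.toCL) hm hBm hI (abs_nonneg p.1) p.2
    have hSc : Continuous S := continuous_of_isSemilinearSol_sinh hm hBm hI hS
    have hSZ (t s : ℝ) : IsSemilinearSol (μ 2 • B) V₀.toCL (μ 3 • integralCL L) sinhC (Z t)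
        (s • traceCL L) (S (Z t, s • traceCL L)) := by
      have := hS (Z t, s • traceCL L)
      rwa [abs_of_nonneg (hZ0 t)] at this
    have hmeas : AEStronglyMeasurable (fun t => S (Z t, u t • traceCL L)) (vol T) :=
      hSc.comp_aestronglyMeasurable (hZc.aestronglyMeasurable.prodMk
        ((Lp.aestronglyMeasurable u).smul_const _))
    have hmem : MemLp (fun t => S (Z t, u t • traceCL L)) ⊤ (vol T) := by
      refine memLp_top_of_bound hmeas (ceP / (μa 2 * κa) * max ‖ua‖ ‖ub‖) ?_
      filter_upwards [ae_abs_le_of_mem_Uad hu] with t ht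
      exact (hbound (hZ0 t) (hSZ t (u t))).trans (by gcongr)
    refine ⟨hmem.toLp, (hsol _).2 ?_, fun q hq => Lp.ext ?_⟩
    · filter_upwards [hmem.coeFn_toLp] with t ht
      rw [ht]
      exact hSZ t (u t)
    · filter_upwards [hmem.coeFn_toLp, (hsol q).1 hq] with t ht hqt
      rw [ht, ← sub_eq_zero, ← norm_eq_zero]
      have := hqt.norm_sub_le hBm hI sinhC_monotone (hZ0 t) (hSZ t (u t))
      simp only [sub_self, norm_zero, zero_mul, mul_zero, add_zero] at this
      exact le_antisymm (nonpos_of_mul_nonpos_right this hm) (norm_nonneg _)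
  · filter_upwards [(hsol q).1 hq, ae_abs_le_of_mem_Uad hu] with t ht htu
    refine ⟨V₀.norm_toC_le_of_const he hP (q t), ?_, by gcongr⟩
    have := mul_le_mul_of_nonneg_left (hbound (hZ0 t) ht) hceP0.le
    rwa [← mul_assoc ceP] at this
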